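/- **Setting.** Let $f:\mathbb{R}^n\to\mathbb{R}$ be twice continuously differentiable (possibly non-convex) with $\|\nabla^2 f(y)-\nabla^2 f(x)\|\le L\|y-x\|$ for all $x,y\in\mathbb{R}^n$, where $L\ge 0$ (assumption A1). Let $\psi:\mathbb{R}^n\to\mathbb{R}\cup\{+\infty\}$ be proper, closed and convex, $Q=\operatorname{dom}\psi$, $F=f+\psi$, and assume $F^\star=\inf_{x\in Q}F(x)>-\infty$. Here $\|\cdot\|$ is the Euclidean norm, respectively the spectral norm, and $\partial\psi$ is the convex subdifferential. Let $x_0\in Q$, $\tau_0>0$, $\varepsilon>0$ and let $m\ge1$ be an integer. **Procedure** $\mathtt{ZeroOrderCubicSteps}(x,B,\sigma,m,\varepsilon)$. Start with $x(0)=x$. For $t=0,1,\dots,m-1$: with $h_g=3^{-1/3}\bigl[\varepsilon m/(\sigma n^{1/2})\bigr]^{1/2}$ compute the central-difference gradient $g_t^{(i)}=\dfrac{f(x(t)+h_ge_i)-f(x(t)-h_ge_i)}{2h_g}$, $i=1,\dots,n$. With $$M(y)=f(x(t))+\langle g_t,y-x(t)\rangle+\tfrac12\langle B(y-x(t)),y-x(t)\rangle+\tfrac{\sigma}{6}\|y-x(t)\|^3,$$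 choose any $x(t+1)\in Q$ and $\psi'(x(t+1))\in\partial\psi(x(t+1))$ such that $$M(x(t+1))+\psi(x(t+1))\le F(x(t)),\qquad \|\nabla M(x(t+1))+\psi'(x(t+1))\|\le\tfrac{\sigma}{4}\|x(t+1)-x(t)\|^2 .$$ If $F(x(0))-F(x(t+1))<\frac{\varepsilon^{3/2}}{384\,\sigma^{1/2}}(t+1)$, stop and return $(x(t+1),\mathtt{halt})$. If all $m$ steps are carried out without halting, return $(x(m),\mathtt{success})$. **Zero-Order CNM.** For $k=0,1,2,\dots$: for $\ell=0,1,2,\dots$ set $$\sigma_{k,\ell}=2^4\bigl(\tfrac23\bigr)^{1/3}(2^\ell\tau_k)\,m,\qquad h_{k,\ell}=\Bigl[\frac{3^4\,\sigma_{k,\ell}^{3/2}\,\varepsilon^{3/2}}{2^{14}\cdot192\; n^3(2^\ell\tau_k)^3}\Bigr]^{1/3},$$ compute, with $h=h_{k,\ell}$, the matrix $A^{(i,j)}=\dfrac{f(x_k+he_i+he_j)-f(x_k+he_i)-f(x_k+he_j)+f(x_k)}{h^2}$ and $B_{k,\ell}=\frac12(A+A^\top)$, and call $\mathtt{ZeroOrderCubicSteps}(x_k,B_{k,\ell},\sigma_{k,\ell},m,\varepsilon)$,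 whose iterates are denoted $x_{k,\ell}(t)$. On $\mathtt{halt}$ continue with $\ell+1$. On $\mathtt{success}$ let $\ell_k:=\ell$, let $x_{k+1}$ be the returned point, set $\tau_{k+1}=\max\{\tau_0,\,2^{\ell_k-1}\tau_k\}$, and pass to $k+1$. Function evaluations are counted as follows: each computation of $B_{k,\ell}$ costs $1+3n^2$, each computation of $g_t$ costs $2n$, and each computation of $F(x(t+1))$ in the decrease test costs $1$. **Theorem (global complexity of Zero-Order CNM).** For every execution of the method, let $T(\varepsilon)$ be the first outer iteration index $k$ such that $$\|\nabla f(x_{k,\ell}(t))+\psi'(x_{k,\ell}(t))\|\le\varepsilon$$ for some generated iterate $x_{k,\ell}(t)$ with $\ell\ge0$, $t\in\{0,\dots,m\}$; here $\psi'(x_{k,\ell}(t))$ is the subgradient delivered with the inexact step if $t\ge1$, and some element of $\partial\psi(x_{k,\ell}(0))$ if $t=0$. Then $T(\varepsilon)$ is finite and $$T(\varepsilon)\;\le\;\frac{384\cdot2^{5/2}\,(\tfrac23)^{1/6}\,\max\{\tau_0,L\}^{1/2}\,(F(x_0)-F^\star)}{\sqrt m}\;\varepsilon^{-3/2}.$$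 Moreover, the total number $\mathrm{ZO}_{T(\varepsilon)}$ of evaluations of $f$ performed during the first $T(\varepsilon)$ outer iterations $k=0,\dots,T(\varepsilon)-1$ satisfies $$\mathrm{ZO}_{T(\varepsilon)}\;\le\;C\Bigl(\frac{mn+n^2}{\sqrt m}\max\{\tau_0,L\}^{1/2}(F(x_0)-F^\star)\,\varepsilon^{-3/2}+(mn+3n^2)\log_2\frac{\max\{\tau_0,L\}}{\tau_0}\Bigr)$$ with an absolute constant $C>0$. -/

import Mathlib

noncomputable section

namespace ZeroOrderCNM

/-- The space `ℝⁿ` with its Euclidean norm. -/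
abbrev Vec (n : ℕ) : Type := EuclideanSpace ℝ (Fin n)

/-! ### The composite problem: minimize `F = f + ψ` over `Q = dom ψ` -/

/-- `ψ : ℝⁿ → ℝ ∪ {+∞}` is proper, closed and convex (convexity through the epigraph). -/
structure IsProperClosedConvex {n : ℕ} (ψ : Vec n → EReal) : Prop where
  ne_bot : ∀ x, ψ x ≠ ⊥
  proper : ∃ x, ψ x ≠ ⊤
  closed : LowerSemicontinuous ψ
  convex : Convex ℝ {p : Vec n × ℝ | ψ p.1 ≤ (p.2 : EReal)}

/-- The effective domain `Q = dom ψ`. -/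
def dom {n : ℕ} (ψ : Vec n → EReal) : Set (Vec n) := {x | ψ x ≠ ⊤}

/-- The objective `F = f + ψ`, as a real number; it is only used at points of `dom ψ`. -/
def objective {n : ℕ} (f : Vec n → ℝ) (ψ : Vec n → EReal) (x : Vec n) : ℝ :=
  f x + (ψ x).toReal

/-- The optimal value `F⋆ = inf_{x ∈ Q} F x`. -/
def optimalValue {n : ℕ} (f : Vec n → ℝ) (ψ : Vec n → EReal) : ℝ :=
  sInf (objective f ψ '' dom ψ)

/-- The subdifferential `∂ψ(x)` of convex analysis. -/
def subdifferential {n : ℕ} (ψ : Vec n → EReal) (x : Vec n) : Set (Vec n) :=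
  {v | x ∈ dom ψ ∧ ∀ y, ψ x + ((inner ℝ v (y - x) : ℝ) : EReal) ≤ ψ y}

/-- The Hessian `∇²f(x)` as a linear operator; its operator norm is the spectral norm. -/
def hessian {n : ℕ} (f : Vec n → ℝ) (x : Vec n) : Vec n →L[ℝ] Vec n :=
  fderiv ℝ (gradient f) x

/-! ### Finite differences, with the list of points at which they evaluate `f` -/

/-- The standard basis vector `eᵢ`. -/
def stdVec {n : ℕ} (i : Fin n) : Vec n := EuclideanSpace.single i 1

/-- Central-difference approximation of `∇f(x)` with step `h`. -/
def fdGradient {n : ℕ} (f : Vec n → ℝ) (x : Vec n) (h : ℝ) : Vec n :=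
  WithLp.toLp 2 fun i => (f (x + h • stdVec i) - f (x - h • stdVec i)) / (2 * h)

/-- Points at which `fdGradient f x h` evaluates `f`. -/
def gradientQueries {n : ℕ} (x : Vec n) (h : ℝ) : List (Vec n) :=
  (List.finRange n).flatMap fun i => [x + h • stdVec i, x - h • stdVec i]

/-- Second-order finite-difference matrix `A` with step `h`. -/
def fdMatrix {n : ℕ} (f : Vec n → ℝ) (x : Vec n) (h : ℝ) : Matrix (Fin n) (Fin n) ℝ :=
  Matrix.of fun i j =>
    (f (x + h • stdVec i + h • stdVec j) - f (x + h • stdVec i) - f (x + h • stdVec j) + f x)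
      / h ^ 2

/-- The Hessian approximation `B = (A + Aᵀ) / 2`. -/
def fdHessian {n : ℕ} (f : Vec n → ℝ) (x : Vec n) (h : ℝ) : Matrix (Fin n) (Fin n) ℝ :=
  (1 / 2 : ℝ) • (fdMatrix f x h + (fdMatrix f x h).transpose)

/-- Points at which `fdHessian f x h` evaluates `f`: the point `x` once, and three points for each
pair `(i, j)`. -/
def hessianQueries {n : ℕ} (x : Vec n) (h : ℝ) : List (Vec n) :=
  x :: (List.finRange n).flatMap fun i => (List.finRange n).flatMap fun j =>
    [x + h • stdVec i + h • stdVec j, x + h • stdVec i, x + h • stdVec j]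

/-! ### The inexact cubic step -/

/-- The cubic model
`M(y) = f(x) + ⟨g, y - x⟩ + ½ ⟨B (y - x), y - x⟩ + (σ / 6) ‖y - x‖³`. -/
def cubicModel {n : ℕ} (f : Vec n → ℝ) (x g : Vec n) (B : Matrix (Fin n) (Fin n) ℝ) (σ : ℝ)
    (y : Vec n) : ℝ :=
  f x + inner ℝ g (y - x) + 1 / 2 * inner ℝ (Matrix.toEuclideanLin B (y - x)) (y - x)
    + σ / 6 * ‖y - x‖ ^ 3

/-- `y`, together with the subgradient `v = ψ'(y) ∈ ∂ψ(y)`, is accepted as an approximate minimizer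
over `Q` of the cubic model at `x` plus `ψ`. -/
structure IsInexactStep {n : ℕ} (f : Vec n → ℝ) (ψ : Vec n → EReal) (x g : Vec n)
    (B : Matrix (Fin n) (Fin n) ℝ) (σ : ℝ) (y v : Vec n) : Prop where
  mem_dom : y ∈ dom ψ
  mem_subdifferential : v ∈ subdifferential ψ y
  model_le : cubicModel f x g B σ y + (ψ y).toReal ≤ objective f ψ x
  gradient_le : ‖gradient (cubicModel f x g B σ) y + v‖ ≤ σ / 4 * ‖y - x‖ ^ 2

/-! ### The algorithm -/

/-- The regularization parameter `σ = 2⁴ (2/3)^{1/3} (2^ℓ τ) m`. -/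
def regularization (m ℓ : ℕ) (τ : ℝ) : ℝ :=
  2 ^ 4 * (2 / 3 : ℝ) ^ (1 / 3 : ℝ) * (2 ^ ℓ * τ) * m

/-- The finite-difference interval `h` for the Hessian. -/
def hessianInterval (n m ℓ : ℕ) (τ ε : ℝ) : ℝ :=
  (3 ^ 4 * regularization m ℓ τ ^ (3 / 2 : ℝ) * ε ^ (3 / 2 : ℝ)
    / (2 ^ 14 * 192 * (n : ℝ) ^ 3 * (2 ^ ℓ * τ) ^ 3)) ^ (1 / 3 : ℝ)

/-- The finite-difference interval `h_g` for the gradients. -/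
def gradientInterval (n m : ℕ) (σ ε : ℝ) : ℝ :=
  1 / (3 : ℝ) ^ (1 / 3 : ℝ) * (ε * m / (σ * (n : ℝ) ^ (1 / 2 : ℝ))) ^ (1 / 2 : ℝ)

/-- Where the computation stands within the current outer iteration `k` and inner loop `ℓ`.
* `estimate`: the Hessian approximation is about to be computed;
* `loop t x B`: the cubic-steps procedure has its iterate `x = x_{k,ℓ}(t)`, and is about to return
  (if `t = m`) or to compute the next iterate;
* `test t B y v`: the procedure has just computed the iterate `y = x_{k,ℓ}(t + 1)` with its
  subgradient `v = ψ'(y)`, and is about to test the decrease of the objective. -/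
inductive Stage (n : ℕ) : Type
  | estimate : Stage n
  | loop (t : ℕ) (x : Vec n) (B : Matrix (Fin n) (Fin n) ℝ) : Stage n
  | test (t : ℕ) (B : Matrix (Fin n) (Fin n) ℝ) (y v : Vec n) : Stage n

/-- A configuration: the outer iteration `k`, the inner loop `ℓ`, the outer iterate `x_k`, the
estimate `τ_k`, the stage, and the list of all evaluations of `f` performed so far. -/
structure Config (n : ℕ) : Type where
  k : ℕ
  ℓ : ℕ
  xk : Vec n
  τ : ℝ
  stage : Stage n
  evals : List (Vec n)

/-- One transition of the zeroth-order cubic Newton method. -/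
inductive Transition {n : ℕ} (f : Vec n → ℝ) (ψ : Vec n → EReal) (τ₀ ε : ℝ) (m : ℕ) :
    Config n → Config n → Prop
  /-- Compute `B_{k,ℓ}` and call the cubic-steps procedure from `x_k`. -/
  | estimate (k ℓ : ℕ) (xk : Vec n) (τ : ℝ) (evals : List (Vec n)) :
      Transition f ψ τ₀ ε m
        ⟨k, ℓ, xk, τ, .estimate, evals⟩
        ⟨k, ℓ, xk, τ, .loop 0 xk (fdHessian f xk (hessianInterval n m ℓ τ ε)),
          evals ++ hessianQueries xk (hessianInterval n m ℓ τ ε)⟩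
  /-- Compute the gradient approximation and an inexact cubic step. -/
  | cubic (k ℓ : ℕ) (xk : Vec n) (τ : ℝ) (evals : List (Vec n)) (t : ℕ) (x : Vec n)
      (B : Matrix (Fin n) (Fin n) ℝ) (y v : Vec n) (ht : t < m)
      (hy : IsInexactStep f ψ x
        (fdGradient f x (gradientInterval n m (regularization m ℓ τ) ε)) B
        (regularization m ℓ τ) y v) :
      Transition f ψ τ₀ ε m
        ⟨k, ℓ, xk, τ, .loop t x B, evals⟩
        ⟨k, ℓ, xk, τ, .test t B y v,
          evals ++ gradientQueries x (gradientInterval n m (regularization m ℓ τ) ε)⟩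
  /-- Sufficient decrease: continue with the cubic steps. -/
  | accept (k ℓ : ℕ) (xk : Vec n) (τ : ℝ) (evals : List (Vec n)) (t : ℕ)
      (B : Matrix (Fin n) (Fin n) ℝ) (y v : Vec n)
      (hdec : ε ^ (3 / 2 : ℝ) / (384 * regularization m ℓ τ ^ (1 / 2 : ℝ)) * ((t : ℝ) + 1)
        ≤ objective f ψ xk - objective f ψ y) :
      Transition f ψ τ₀ ε m
        ⟨k, ℓ, xk, τ, .test t B y v, evals⟩
        ⟨k, ℓ, xk, τ, .loop (t + 1) y B, evals ++ [y]⟩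
  /-- Insufficient decrease: the procedure returns `halt`; restart from `x_k` with `ℓ + 1`. -/
  | halt (k ℓ : ℕ) (xk : Vec n) (τ : ℝ) (evals : List (Vec n)) (t : ℕ)
      (B : Matrix (Fin n) (Fin n) ℝ) (y v : Vec n)
      (hdec : objective f ψ xk - objective f ψ y
        < ε ^ (3 / 2 : ℝ) / (384 * regularization m ℓ τ ^ (1 / 2 : ℝ)) * ((t : ℝ) + 1)) :
      Transition f ψ τ₀ ε m
        ⟨k, ℓ, xk, τ, .test t B y v, evals⟩
        ⟨k, ℓ + 1, xk, τ, .estimate, evals ++ [y]⟩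
  /-- After `m` steps the procedure returns `success`; start outer iteration `k + 1` with
  `x_{k+1} = x_{k,ℓ}(m)` and `τ_{k+1} = max {τ₀, 2^{ℓ-1} τ_k}`. -/
  | success (k ℓ : ℕ) (xk : Vec n) (τ : ℝ) (evals : List (Vec n)) (x : Vec n)
      (B : Matrix (Fin n) (Fin n) ℝ) :
      Transition f ψ τ₀ ε m
        ⟨k, ℓ, xk, τ, .loop m x B, evals⟩
        ⟨k + 1, 0, x, max τ₀ ((2 : ℝ) ^ ((ℓ : ℤ) - 1) * τ), .estimate, evals⟩

/-- `c` is an execution of the method from `x₀` (the method has no stopping rule, so that an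
execution is an infinite sequence of configurations). -/
structure IsRun {n : ℕ} (f : Vec n → ℝ) (ψ : Vec n → EReal) (τ₀ ε : ℝ) (m : ℕ) (x₀ : Vec n)
    (c : ℕ → Config n) : Prop where
  init : c 0 = ⟨0, 0, x₀, τ₀, .estimate, []⟩
  next : ∀ i, Transition f ψ τ₀ ε m (c i) (c (i + 1))

/-- In the configuration `a`, the point `x` is the current iterate `x_{k,ℓ}(t)` and `v ∈ ∂ψ(x)` is
a subgradient that goes with it: the one delivered with the inexact step for `t ≥ 1`, and
any subgradient for the starting point `t = 0`. -/
def IsIterate {n : ℕ} (ψ : Vec n → EReal) (a : Config n) (t : ℕ) (x v : Vec n) : Prop :=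
  match a.stage with
  | .estimate => False
  | .loop s y _ => s = 0 ∧ t = 0 ∧ x = y ∧ v ∈ subdifferential ψ x
  | .test s _ y w => t = s + 1 ∧ x = y ∧ v = w

/-- The outer iterations `k` in which, for some `ℓ ≥ 0` and `t ∈ {0, …, m}`,
`‖∇f(x_{k,ℓ}(t)) + ψ'(x_{k,ℓ}(t))‖ ≤ ε`. -/
def stationaryIterations {n : ℕ} (f : Vec n → ℝ) (ψ : Vec n → EReal) (ε : ℝ) (m : ℕ)
    (c : ℕ → Config n) : Set ℕ :=
  {k | ∃ (i ℓ t : ℕ) (x v : Vec n), (c i).k = k ∧ (c i).ℓ = ℓ ∧ t ≤ m ∧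
    IsIterate ψ (c i) t x v ∧ ‖gradient f x + v‖ ≤ ε}

/-- The total number of evaluations of `f` performed by the transitions that belong to the first
`T` outer iterations `k = 0, …, T - 1`. -/
def evaluationsInFirst {n : ℕ} (c : ℕ → Config n) (T : ℕ) : ℕ∞ :=
  ⨆ (i : ℕ) (_ : (c i).k < T), ((c (i + 1)).evals.length : ℕ∞)

end ZeroOrderCNM

end

/-! The heart is one call of the cubic-steps procedure with `L ≤ 2 ^ ℓ * τ`, hence `12 * L * m ≤ σ`.
Measure lengths in units of `√ε / √σ` and values of `F` in units of `√ε ^ 3 / √σ`. If `y` is not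
`ε`-stationary, the residual bound of the inexact step forces either a long step or a badly outdated
Hessian. So a step of normalized length `ρ` decreases `F` by at least `1 / 384 + ρ ^ 3 / 48 - 32 * S
^ 3`, where `S` measures the drift of the Hessian since `xk` (`normalized_decrease`). The drift is
at most `L` times the distance travelled, and the cube of that distance is controlled by the cubes
of the earlier steps (`add_cube_le`). Since `σ` grows like `m`, the gains `ρ ^ 3 / 48` pay for the
drift during all `m` steps, and `1 / 384` per step remains (`AccumulatedDecrease.step`). The
decrease test then cannot fail.

Thus a halt without a stationary iterate implies `2 ^ ℓ * τ < L`. Every `τ_k` stays below `max τ₀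
L`, and each outer iteration before the first stationary one ends and lowers `F` by `outerDecrease`.
Boundedness below limits their number. The calls are counted by telescoping `log₂ τ_k`, each costing
at most `callCost` (`IsRun.exists_outerState_succ`). -/

noncomputable section

namespace ZeroOrderCNM

open Set

/-! ### Taylor remainders under a Lipschitz Hessian. -/

section Taylor

variable {n : ℕ} {f : Vec n → ℝ} {L : ℝ}

lemma hasFDerivAt_gradient (hf : ContDiff ℝ 2 f) (x : Vec n) :
    HasFDerivAt (gradient f) (hessian f x) x := by
  have h : ContDiff ℝ 1 (gradient f) :=
    (InnerProductSpace.toDual ℝ (Vec n)).symm.contDiff.comp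
      (hf.fderiv_right (m := 1) (by norm_num))
  exact (h.differentiable (by norm_num) x).hasFDerivAt

lemma inner_hessian_symm (hf : ContDiff ℝ 2 f) (x u w : Vec n) :
    inner ℝ (hessian f x u) w = inner ℝ (hessian f x w) u := by
  have key : ∀ a b, inner ℝ (hessian f x a) b = fderiv ℝ (fderiv ℝ f) x a b := by
    intro a b
    have h1 : HasFDerivAt (fun y => fderiv ℝ f y b)
        ((innerSL ℝ b).comp (hessian f x)) x := by
      refine ((innerSL ℝ b).hasFDerivAt.comp x (hasFDerivAt_gradient hf x)).congr_of_eventuallyEq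
        (Filter.Eventually.of_forall fun y => ?_)
      simp
    have h2 : HasFDerivAt (fun y => fderiv ℝ f y b) ((fderiv ℝ (fderiv ℝ f) x).flip b) x :=
      (ContinuousLinearMap.apply ℝ ℝ b).hasFDerivAt.comp x
        ((hf.fderiv_right (m := 1) (by norm_num)).differentiable (by norm_num) x).hasFDerivAt
    have := congrArg (fun l => l a) (h1.unique h2)
    simpa [real_inner_comm] using this
  rw [key, key]
  have := hf.contDiffAt (x := x) |>.isSymmSndFDerivAt (by simp)
  exact this u w

lemma norm_gradient_sub_taylor_le (hf : ContDiff ℝ 2 f)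
    (hL : ∀ x y, ‖hessian f y - hessian f x‖ ≤ L * ‖y - x‖) (x d : Vec n) :
    ‖gradient f (x + d) - gradient f x - hessian f x d‖ ≤ L / 2 * ‖d‖ ^ 2 := by
  have hder : ∀ s : ℝ, HasDerivAt
      (fun s : ℝ => gradient f (x + s • d) - gradient f x - s • hessian f x d)
      (hessian f (x + s • d) d - hessian f x d) s := by
    intro s
    have h1 : HasDerivAt (fun s : ℝ => x + s • d) d s := by
      simpa using ((hasDerivAt_id s).smul_const d).const_add x
    have h2 := (hasFDerivAt_gradient hf (x + s • d)).comp_hasDerivAt s h1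
    exact ((h2.sub_const (gradient f x)).sub
      ((hasDerivAt_id s).smul_const (hessian f x d))).congr_deriv (by simp)
  -- In place of integrating: the remainder along the segment vanishes at `s = 0`, and its
  -- derivative has norm at most the derivative of the power of `s` on the right.
  have := image_norm_le_of_norm_deriv_right_le_deriv_boundary (a := 0) (b := 1)
    (fun s _ => (hder s).continuousAt.continuousWithinAt)
    (fun s _ => (hder s).hasDerivWithinAt)
    (B := fun s => L / 2 * ‖d‖ ^ 2 * s ^ 2) (B' := fun s => L * ‖d‖ ^ 2 * s)
    (by simp)
    (fun s => by
      exact ((hasDerivAt_pow 2 s).const_mul (L / 2 * ‖d‖ ^ 2)).congr_deriv (by norm_num; ring))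
    (fun s hs => by
      rw [← sub_apply]
      refine (ContinuousLinearMap.le_opNorm _ _).trans ?_
      refine (mul_le_mul_of_nonneg_right (hL x (x + s • d)) (norm_nonneg d)).trans_eq ?_
      rw [add_sub_cancel_left, norm_smul, Real.norm_of_nonneg hs.1]
      ring)
    (right_mem_Icc.2 zero_le_one)
  simpa using this

lemma abs_sub_taylor_le (hf : ContDiff ℝ 2 f)
    (hL : ∀ x y, ‖hessian f y - hessian f x‖ ≤ L * ‖y - x‖) (x d : Vec n) :
    |f (x + d) - f x - inner ℝ (gradient f x) d - 1 / 2 * inner ℝ (hessian f x d) d|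
      ≤ L / 6 * ‖d‖ ^ 3 := by
  have hder : ∀ s : ℝ, HasDerivAt
      (fun s : ℝ => f (x + s • d) - f x - s * inner ℝ (gradient f x) d
        - s ^ 2 * (1 / 2 * inner ℝ (hessian f x d) d))
      (inner ℝ (gradient f (x + s • d) - gradient f x - hessian f x (s • d)) d) s := by
    intro s
    have h1 : HasDerivAt (fun s : ℝ => x + s • d) d s := by
      simpa using ((hasDerivAt_id s).smul_const d).const_add x
    have h2 := ((hf.differentiable (by norm_num)) (x + s • d)).hasFDerivAt.comp_hasDerivAt s h1
    have h3 := ((h2.sub_const (f x)).sub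
      ((hasDerivAt_id s).mul_const (inner ℝ (gradient f x) d))).sub
      ((hasDerivAt_pow 2 s).mul_const (1 / 2 * inner ℝ (hessian f x d) d))
    refine h3.congr_deriv ?_
    rw [inner_sub_left, inner_sub_left, inner_gradient_left, map_smul, inner_smul_left]
    simp
    ring
  have := image_norm_le_of_norm_deriv_right_le_deriv_boundary (a := 0) (b := 1)
    (fun s _ => (hder s).continuousAt.continuousWithinAt)
    (fun s _ => (hder s).hasDerivWithinAt)
    (B := fun s => L / 6 * ‖d‖ ^ 3 * s ^ 3) (B' := fun s => L / 2 * ‖d‖ ^ 3 * s ^ 2)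
    (by simp)
    (fun s => by
      exact ((hasDerivAt_pow 3 s).const_mul (L / 6 * ‖d‖ ^ 3)).congr_deriv (by norm_num; ring))
    (fun s hs => by
      refine (norm_inner_le_norm _ _).trans ?_
      refine (mul_le_mul_of_nonneg_right (norm_gradient_sub_taylor_le hf hL x (s • d))
        (norm_nonneg d)).trans_eq ?_
      rw [norm_smul, Real.norm_of_nonneg hs.1]
      ring)
    (right_mem_Icc.2 zero_le_one)
  simpa using this

end Taylor

/-! ### Errors of the finite-difference gradient and Hessian. -/

section FiniteDifferences

variable {n : ℕ} {f : Vec n → ℝ} {L : ℝ}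

@[simp] lemma norm_stdVec (i : Fin n) : ‖stdVec i‖ = 1 := by simp [stdVec]

@[simp] lemma inner_stdVec (v : Vec n) (i : Fin n) : inner ℝ v (stdVec i) = v i := by
  simp [stdVec, EuclideanSpace.inner_single_right]

lemma norm_le_sqrt_mul_of_abs_le {v : Vec n} {η : ℝ} (hη : 0 ≤ η) (hv : ∀ i, |v i| ≤ η) :
    ‖v‖ ≤ Real.sqrt n * η := by
  rw [EuclideanSpace.norm_eq]
  have h : ∑ i, ‖v i‖ ^ 2 ≤ n * η ^ 2 := by
    refine (Finset.sum_le_sum fun i _ =>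
      pow_le_pow_left₀ (norm_nonneg _) (hv i) 2).trans_eq ?_
    simp
  refine (Real.sqrt_le_sqrt h).trans_eq ?_
  rw [Real.sqrt_mul (by positivity), Real.sqrt_sq hη]

lemma sum_abs_le_sqrt_mul_norm (v : Vec n) : ∑ i, |v i| ≤ Real.sqrt n * ‖v‖ := by
  rw [EuclideanSpace.norm_eq, ← Real.sqrt_mul (by positivity)]
  refine Real.le_sqrt_of_sq_le ?_
  simpa using sq_sum_le_card_mul_sum_sq (s := Finset.univ) (f := fun i => |v i|)

/-- Each factor `√n` comes from comparing norms: once `ℓ¹` with `ℓ²` on the input, once `ℓ²` with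
`ℓ^∞` on the output. -/
lemma norm_apply_le_of_abs_inner_le (E : Vec n →ₗ[ℝ] Vec n) {η : ℝ} (hη : 0 ≤ η)
    (hE : ∀ i j, |E (stdVec j) i| ≤ η) (d : Vec n) : ‖E d‖ ≤ n * η * ‖d‖ := by
  have hd : d = ∑ j, d j • stdVec j := by
    ext i
    simp [stdVec, Pi.single_apply]
  have h : ∀ i, |E d i| ≤ η * (Real.sqrt n * ‖d‖) := by
    intro i
    have : E d i = ∑ j, d j * E (stdVec j) i := by
      conv_lhs => rw [hd]
      simp
    rw [this]
    calc |∑ j, d j * E (stdVec j) i| ≤ ∑ j, |d j * E (stdVec j) i| :=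
          Finset.abs_sum_le_sum_abs _ _
      _ ≤ ∑ j, η * |d j| := Finset.sum_le_sum fun j _ => by
          rw [abs_mul, mul_comm]
          exact mul_le_mul_of_nonneg_right (hE i j) (abs_nonneg _)
      _ = η * ∑ j, |d j| := by rw [Finset.mul_sum]
      _ ≤ _ := mul_le_mul_of_nonneg_left (sum_abs_le_sqrt_mul_norm d) hη
  refine (norm_le_sqrt_mul_of_abs_le (by positivity) h).trans_eq ?_
  have := Real.mul_self_sqrt (Nat.cast_nonneg (α := ℝ) n)
  linear_combination η * ‖d‖ * this

/-- The quadratic Taylor terms at `x ± h eᵢ` cancel, so only two remainders `L * h ^ 3 / 6` are left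
to divide by `2 * h`. -/
lemma norm_fdGradient_sub_le (hf : ContDiff ℝ 2 f) (hL0 : 0 ≤ L)
    (hL : ∀ x y, ‖hessian f y - hessian f x‖ ≤ L * ‖y - x‖) (x : Vec n) {h : ℝ} (hh : 0 < h) :
    ‖fdGradient f x h - gradient f x‖ ≤ Real.sqrt n * (L * h ^ 2 / 6) := by
  refine norm_le_sqrt_mul_of_abs_le (by positivity) fun i => ?_
  have h1 := abs_sub_taylor_le hf hL x (h • stdVec i)
  have h2 := abs_sub_taylor_le hf hL x (-(h • stdVec i))
  rw [← sub_eq_add_neg] at h2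
  simp only [norm_neg, norm_smul, norm_stdVec, Real.norm_of_nonneg hh.le, inner_neg_right,
    inner_neg_left, map_neg, mul_one, inner_smul_right, inner_stdVec] at h1 h2
  simp only [PiLp.sub_apply, fdGradient]
  have : (f (x + h • stdVec i) - f (x - h • stdVec i)) / (2 * h) - gradient f x i
      = (f (x + h • stdVec i) - f (x - h • stdVec i) - 2 * h * gradient f x i) / (2 * h) := by
    field_simp
  rw [this, abs_div, abs_of_pos (by positivity : 0 < 2 * h), div_le_iff₀ (by positivity)]
  rw [abs_le] at *
  constructor <;> nlinarith

lemma fdMatrix_symm (f : Vec n → ℝ) (x : Vec n) (h : ℝ) (i j : Fin n) :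
    fdMatrix f x h i j = fdMatrix f x h j i := by
  simp only [fdMatrix, Matrix.of_apply]
  rw [add_right_comm x]
  ring

lemma fdHessian_apply (f : Vec n → ℝ) (x : Vec n) (h : ℝ) (i j : Fin n) :
    fdHessian f x h i j = fdMatrix f x h i j := by
  simp only [fdHessian, Matrix.smul_apply, Matrix.add_apply, Matrix.transpose_apply,
    fdMatrix_symm f x h j i, smul_eq_mul]
  ring

lemma fdHessian_isHermitian (f : Vec n → ℝ) (x : Vec n) (h : ℝ) :
    (fdHessian f x h).IsHermitian := by
  ext i j
  simp [fdHessian_apply, fdMatrix_symm f x h j i]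

lemma abs_fdMatrix_sub_le (hf : ContDiff ℝ 2 f) (hL0 : 0 ≤ L)
    (hL : ∀ x y, ‖hessian f y - hessian f x‖ ≤ L * ‖y - x‖) (x : Vec n) {h : ℝ} (hh : 0 < h)
    (i j : Fin n) :
    |fdMatrix f x h i j - hessian f x (stdVec j) i| ≤ 5 / 3 * (L * h) := by
  have h1 := abs_sub_taylor_le hf hL x (h • stdVec i)
  have h2 := abs_sub_taylor_le hf hL x (h • stdVec j)
  have h3 := abs_sub_taylor_le hf hL x (h • stdVec i + h • stdVec j)
  have hn : ‖h • stdVec i + h • (stdVec j : Vec n)‖ ≤ 2 * h := by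
    refine (norm_add_le _ _).trans_eq ?_
    simp [norm_smul, abs_of_pos hh]; ring
  -- The constant `5 / 3` is `1 / 6 + 1 / 6 + 2 ^ 3 / 6`, one remainder for each displaced point.
  have h4 := h3.trans (mul_le_mul_of_nonneg_left (pow_le_pow_left₀ (norm_nonneg _) hn 3)
    (by positivity : 0 ≤ L / 6))
  -- Symmetry of the Hessian merges the two cross terms of the expansion at `x + h eᵢ + h eⱼ`.
  have hs : hessian f x (stdVec i) j = hessian f x (stdVec j) i := by
    simpa using inner_hessian_symm hf x (stdVec i) (stdVec j)
  simp only [norm_smul, norm_stdVec, Real.norm_of_nonneg hh.le, map_add, map_smul,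
    inner_add_left, inner_smul_left, inner_add_right, RCLike.conj_to_real,
    mul_one, inner_smul_right, inner_stdVec, ← add_assoc, hs] at h1 h2 h4
  simp only [fdMatrix, Matrix.of_apply]
  have : (f (x + h • stdVec i + h • stdVec j) - f (x + h • stdVec i) - f (x + h • stdVec j) + f x)
        / h ^ 2 - hessian f x (stdVec j) i
      = (f (x + h • stdVec i + h • stdVec j) - f (x + h • stdVec i) - f (x + h • stdVec j) + f x
        - h ^ 2 * hessian f x (stdVec j) i) / h ^ 2 := by
    field_simp
  rw [this, abs_div, abs_of_pos (by positivity : 0 < h ^ 2), div_le_iff₀ (by positivity)]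
  rw [abs_le] at *
  constructor <;> linarith

lemma norm_fdHessian_sub_le (hf : ContDiff ℝ 2 f) (hL0 : 0 ≤ L)
    (hL : ∀ x y, ‖hessian f y - hessian f x‖ ≤ L * ‖y - x‖) (x : Vec n) {h : ℝ} (hh : 0 < h)
    (d : Vec n) :
    ‖Matrix.toEuclideanLin (fdHessian f x h) d - hessian f x d‖
      ≤ n * (5 / 3 * (L * h)) * ‖d‖ := by
  refine norm_apply_le_of_abs_inner_le
    (Matrix.toEuclideanLin (fdHessian f x h) - (hessian f x : Vec n →ₗ[ℝ] Vec n))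
    (by positivity) (fun i j => ?_) d
  have : Matrix.toEuclideanLin (fdHessian f x h) (stdVec j) i = fdMatrix f x h i j := by
    simp [stdVec, Matrix.toLpLin_apply, fdHessian_apply]
  simpa [this] using abs_fdMatrix_sub_le hf hL0 hL x hh i j

lemma gradient_cubicModel (f : Vec n → ℝ) (x g : Vec n) {B : Matrix (Fin n) (Fin n) ℝ}
    (hB : B.IsHermitian) (σ : ℝ) (y : Vec n) :
    gradient (cubicModel f x g B σ) y
      = g + Matrix.toEuclideanLin B (y - x) + (σ / 2 * ‖y - x‖) • (y - x) := by
  set A := Matrix.toEuclideanLin B with hA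
  have hsymm : A.IsSymmetric := Matrix.isSymmetric_toEuclideanLin_iff.2 hB
  have hd : HasFDerivAt (fun z : Vec n => z - x) (ContinuousLinearMap.id ℝ (Vec n)) y :=
    (hasFDerivAt_id y).sub_const x
  have hlin := (innerSL ℝ g).hasFDerivAt.comp y hd
  have hquad := ((A.toContinuousLinearMap.hasFDerivAt.comp y hd).inner ℝ hd).const_mul (1 / 2 : ℝ)
  have hcube := ((hasFDerivAt_norm_rpow (y - x) (p := 3) (by norm_num)).comp y hd).const_mul
    (σ / 6)
  have hM := ((hlin.const_add (f x)).add hquad).add hcube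
  refine HasGradientAt.gradient ?_
  rw [hasGradientAt_iff_hasFDerivAt]
  refine (hM.congr_of_eventuallyEq (Filter.Eventually.of_forall fun z => ?_)).congr_fderiv ?_
  · simp [cubicModel, hA]
  · ext w
    have h1 : inner ℝ (A w) (y - x) = inner ℝ (A (y - x)) w := by
      rw [hsymm, real_inner_comm]
    have h2 : (3 : ℝ) - 2 = 1 := by norm_num
    simp [h2, -map_sub, h1]
    ring

end FiniteDifferences

/-! ### Decrease and residual gradient of one inexact cubic step. -/

section InexactStep

variable {n : ℕ} {f : Vec n → ℝ} {ψ : Vec n → EReal} {L σ κg κB : ℝ} {x g y v : Vec n}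
  {B : Matrix (Fin n) (Fin n) ℝ}

lemma IsInexactStep.objective_add_le (hf : ContDiff ℝ 2 f)
    (hL : ∀ x y, ‖hessian f y - hessian f x‖ ≤ L * ‖y - x‖)
    (hg : ‖g - gradient f x‖ ≤ κg)
    (hB : ∀ d, ‖Matrix.toEuclideanLin B d - hessian f x d‖ ≤ κB * ‖d‖)
    (hy : IsInexactStep f ψ x g B σ y v) :
    objective f ψ y + ((σ - L) / 6 * ‖y - x‖ ^ 3 - κg * ‖y - x‖ - κB / 2 * ‖y - x‖ ^ 2)
      ≤ objective f ψ x := by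
  have h1 := le_of_abs_le (abs_sub_taylor_le hf hL x (y - x))
  rw [add_sub_cancel] at h1
  have h2 := hy.model_le
  have h3 : inner ℝ (gradient f x - g) (y - x) ≤ κg * ‖y - x‖ := by
    refine (real_inner_le_norm _ _).trans ?_
    rw [norm_sub_rev]
    exact mul_le_mul_of_nonneg_right hg (norm_nonneg _)
  have h4 : inner ℝ (hessian f x (y - x) - Matrix.toEuclideanLin B (y - x)) (y - x)
      ≤ κB * ‖y - x‖ ^ 2 := by
    refine (real_inner_le_norm _ _).trans ?_
    rw [norm_sub_rev]
    exact (mul_le_mul_of_nonneg_right (hB _) (norm_nonneg _)).trans_eq (by ring)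
  rw [inner_sub_left] at h3 h4
  simp only [cubicModel] at h2
  simp only [objective] at h2 ⊢
  linarith

/-- The coefficient `3 / 4` is `1 / 4` from the acceptance test plus `1 / 2` from the gradient of
the cubic regularizer. -/
lemma IsInexactStep.norm_gradient_add_le (hf : ContDiff ℝ 2 f)
    (hL : ∀ x y, ‖hessian f y - hessian f x‖ ≤ L * ‖y - x‖) (hσ : 0 ≤ σ)
    (hBs : B.IsHermitian) (hg : ‖g - gradient f x‖ ≤ κg)
    (hB : ∀ d, ‖Matrix.toEuclideanLin B d - hessian f x d‖ ≤ κB * ‖d‖)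
    (hy : IsInexactStep f ψ x g B σ y v) :
    ‖gradient f y + v‖
      ≤ (3 / 4 * σ + L / 2) * ‖y - x‖ ^ 2 + κg + κB * ‖y - x‖ := by
  have h1 := norm_gradient_sub_taylor_le hf hL x (y - x)
  rw [add_sub_cancel] at h1
  have h2 := hy.gradient_le
  rw [gradient_cubicModel f x g hBs] at h2
  have h3 : ‖(σ / 2 * ‖y - x‖) • (y - x)‖ = σ / 2 * ‖y - x‖ ^ 2 := by
    rw [norm_smul, Real.norm_of_nonneg (by positivity)]
    ring
  have h4 := hB (y - x)
  have : gradient f y + v =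
      (g + Matrix.toEuclideanLin B (y - x) + (σ / 2 * ‖y - x‖) • (y - x) + v)
      + (gradient f y - gradient f x - hessian f x (y - x))
      - (g - gradient f x)
      - (Matrix.toEuclideanLin B (y - x) - hessian f x (y - x))
      - (σ / 2 * ‖y - x‖) • (y - x) := by abel
  rw [this]
  refine (norm_sub_le _ _).trans ?_
  rw [h3]
  have h5 := norm_sub_le ((g + Matrix.toEuclideanLin B (y - x) + (σ / 2 * ‖y - x‖) • (y - x) + v)
      + (gradient f y - gradient f x - hessian f x (y - x))
      - (g - gradient f x)) (Matrix.toEuclideanLin B (y - x) - hessian f x (y - x))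
  have h6 := norm_sub_le ((g + Matrix.toEuclideanLin B (y - x) + (σ / 2 * ‖y - x‖) • (y - x) + v)
      + (gradient f y - gradient f x - hessian f x (y - x))) (g - gradient f x)
  have h7 := norm_add_le (g + Matrix.toEuclideanLin B (y - x) + (σ / 2 * ‖y - x‖) • (y - x) + v)
      (gradient f y - gradient f x - hessian f x (y - x))
  linarith

end InexactStep

/-! ### Scalar inequalities behind the descent. -/

section Scalar

lemma half_mul_sq_le_cube {S ρ : ℝ} (hS : 0 ≤ S) (hρ : 0 ≤ ρ) :
    1 / 2 * (S * ρ ^ 2) ≤ 32 * S ^ 3 + 1 / 39 * ρ ^ 3 := by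
  -- For fixed `S`, the difference of the two sides as a function of `ρ ≥ 0` is smallest at `ρ = 13
  -- * S`.
  nlinarith [mul_nonneg hS (sq_nonneg (13 * S - ρ)), mul_nonneg hρ (sq_nonneg (13 * S - ρ)),
    pow_nonneg hS 3]

/-- The decrease of one cubic step in the normalization `ε = σ = 1`: `ρ` is the length of the step
and `S` the contribution of the outdated Hessian. -/
lemma normalized_decrease {S ρ : ℝ} (hS : 0 ≤ S) (hρ : 0 ≤ ρ)
    (h : 1 ≤ (3 / 4 + 1 / 24) * ρ ^ 2 + 1 / 72 + (5 / 96 + S) * ρ) :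
    1 / 384 + 1 / 48 * ρ ^ 3 - 32 * S ^ 3
      ≤ 11 / 72 * ρ ^ 3 - 1 / 72 * ρ - (5 / 96 + S) / 2 * ρ ^ 2 := by
  -- For a long step, `ρ ^ 3` dominates the other terms. For a short one, `h` forces `S ≥ 3 / 5`,
  -- and `32 * S ^ 3` makes the left side negative enough.
  rcases le_total (3 / 4) ρ with h1 | h1
  · have h2 := half_mul_sq_le_cube hS hρ
    have h3 : 3 / 4 * ρ ^ 2 ≤ ρ ^ 3 := by
      rw [pow_succ' ρ 2]; exact mul_le_mul_of_nonneg_right h1 (sq_nonneg ρ)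
    nlinarith
  · have h2 : ρ ^ 2 ≤ 9 / 16 := by nlinarith
    have h3 : 3 / 5 ≤ S := by nlinarith [mul_le_mul_of_nonneg_left h1 hS]
    have h4 : S * ρ ^ 2 ≤ S * (9 / 16) := mul_le_mul_of_nonneg_left h2 hS
    have h5 : S * (9 / 25) ≤ S ^ 3 := by
      rw [pow_succ' S 2]; exact mul_le_mul_of_nonneg_left (by nlinarith) hS
    have h6 := pow_nonneg hρ 3
    linarith

/-- Inductive form of `(∑ ρᵢ) ^ 3 ≤ t ^ 2 * ∑ ρᵢ ^ 3`: convexity of the cube, applied to the mean `u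
= w / t` with weight `t` and to `ρ` with weight `1`. -/
lemma add_cube_le {t P w ρ : ℝ} (ht : 0 ≤ t) (hP : 0 ≤ P) (hw : 0 ≤ w) (hρ : 0 ≤ ρ)
    (h : w ^ 3 ≤ t ^ 2 * P) : (w + ρ) ^ 3 ≤ (t + 1) ^ 2 * (P + ρ ^ 3) := by
  rcases ht.eq_or_lt with rfl | ht
  · have : w = 0 := by
      by_contra h0
      have := pow_pos (lt_of_le_of_ne hw (Ne.symm h0)) 3
      linarith
    subst this
    simp only [zero_add, one_pow, one_mul]
    linarith
  · obtain ⟨u, rfl⟩ : ∃ u, w = t * u := ⟨w / t, by field_simp⟩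
    have hu : 0 ≤ u := nonneg_of_mul_nonneg_right hw ht
    have h1 : t * u ^ 3 ≤ P := by
      have : t ^ 2 * (t * u ^ 3) ≤ t ^ 2 * P := by linarith [mul_pow t u 3, h, pow_succ t 2]
      exact le_of_mul_le_mul_left this (by positivity)
    have h2 : (t * u + ρ) ^ 3 ≤ (t + 1) ^ 2 * (t * u ^ 3 + ρ ^ 3) := by
      have h3 : (t + 1) ^ 2 * (t * u ^ 3 + ρ ^ 3) - (t * u + ρ) ^ 3
          = t * (u - ρ) ^ 2 * ((2 * t + 1) * u + (t + 2) * ρ) := by ring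
      have : 0 ≤ t * (u - ρ) ^ 2 * ((2 * t + 1) * u + (t + 2) * ρ) := by positivity
      linarith
    refine h2.trans ?_
    gcongr

end Scalar

/-! ### Accumulated decrease over the steps of one call. -/

section Descent

variable {n : ℕ} {f : Vec n → ℝ} {ψ : Vec n → EReal} {L σ ε t m : ℝ} {xk x g y v : Vec n}
  {B : Matrix (Fin n) (Fin n) ℝ}

/-- The decrease of `F` accumulated in `t` cubic steps from `xk` to `x`, where `P` plays the role of
the sum of the cubes of the normalized lengths of the steps. -/
def AccumulatedDecrease (F : Vec n → ℝ) (ε σ m : ℝ) (xk : Vec n) (t : ℝ) (x : Vec n) : Prop :=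
  ∃ P : ℝ, 0 ≤ P ∧ (√σ / √ε * ‖x - xk‖) ^ 3 ≤ t ^ 2 * P ∧
    F x + √ε ^ 3 / √σ * (1 / 384 * t + (1 / 48 - t ^ 3 / (162 * m ^ 3)) * P) ≤ F xk

lemma AccumulatedDecrease.refl (F : Vec n → ℝ) (ε σ m : ℝ) (xk : Vec n) :
    AccumulatedDecrease F ε σ m xk 0 xk :=
  ⟨0, le_rfl, by simp, by simp⟩

lemma AccumulatedDecrease.le {F : Vec n → ℝ} (h : AccumulatedDecrease F ε σ m xk t x)
    (hm : 0 < m) (ht : 0 ≤ t) (htm : t ≤ m) :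
    √ε ^ 3 / √σ * (1 / 384 * t) ≤ F xk - F x := by
  obtain ⟨P, hP, -, h⟩ := h
  have h1 : t ^ 3 / (162 * m ^ 3) ≤ 1 / 48 := by
    rw [div_le_iff₀ (by positivity)]
    have := pow_le_pow_left₀ ht htm 3
    have := pow_pos hm 3
    linarith
  have h2 : 0 ≤ √ε ^ 3 / √σ * ((1 / 48 - t ^ 3 / (162 * m ^ 3)) * P) :=
    mul_nonneg (by positivity) (mul_nonneg (by linarith) hP)
  rw [mul_add] at h
  linarith

/-- The new step adds `ρ ^ 3` to `P`, while the drift of the Hessian costs at most `t ^ 2 * P / (54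
* m ^ 3)`. The coefficient of `P` absorbs this cost because `t ^ 3 + 3 * t ^ 2 ≤ (t + 1) ^ 3`, and
it stays positive up to `t = m` because `1 / 162 < 1 / 48`. -/
lemma AccumulatedDecrease.step (hf : ContDiff ℝ 2 f) (hL0 : 0 ≤ L)
    (hL : ∀ x y, ‖hessian f y - hessian f x‖ ≤ L * ‖y - x‖)
    (hε : 0 < ε) (hσ : 0 < σ) (hm : 1 ≤ m) (ht : 0 ≤ t) (hLσ : 12 * L * m ≤ σ)
    (hBs : B.IsHermitian) (hg : ‖g - gradient f x‖ ≤ ε / 72)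
    (hB : ∀ d, ‖Matrix.toEuclideanLin B d - hessian f xk d‖ ≤ 5 / 96 * (√ε * √σ) * ‖d‖)
    (h : AccumulatedDecrease (objective f ψ) ε σ m xk t x)
    (hy : IsInexactStep f ψ x g B σ y v) (hns : ε < ‖gradient f y + v‖) :
    AccumulatedDecrease (objective f ψ) ε σ m xk (t + 1) y := by
  obtain ⟨P, hP, hw, hF⟩ := h
  have hB' : ∀ d, ‖Matrix.toEuclideanLin B d - hessian f x d‖
      ≤ (5 / 96 * (√ε * √σ) + L * ‖x - xk‖) * ‖d‖ := by
    intro d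
    have h1 : Matrix.toEuclideanLin B d - hessian f x d
        = (Matrix.toEuclideanLin B d - hessian f xk d) - (hessian f x - hessian f xk) d := by
      rw [sub_apply]; abel
    have h2 := (hessian f x - hessian f xk).le_opNorm d
    have h3 := mul_le_mul_of_nonneg_right (hL xk x) (norm_nonneg d)
    rw [h1]
    refine (norm_sub_le _ _).trans ?_
    linarith [hB d]
  have hdec := hy.objective_add_le hf hL hg hB'
  have hgrad := hns.le.trans (hy.norm_gradient_add_le hf hL hσ.le hBs hg hB')
  have htri : ‖y - xk‖ ≤ ‖x - xk‖ + ‖y - x‖ := by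
    rw [← sub_add_sub_cancel y x xk, add_comm]; exact norm_add_le _ _
  have ha : 0 < √ε := Real.sqrt_pos.2 hε
  have hb : 0 < √σ := Real.sqrt_pos.2 hσ
  have hεa : ε = √ε ^ 2 := (Real.sq_sqrt hε.le).symm
  have hσb : σ = √σ ^ 2 := (Real.sq_sqrt hσ.le).symm
  unfold AccumulatedDecrease
  -- With `ε = a ^ 2` and `σ = b ^ 2`, the normalization by `a / b` becomes rational and
  -- `field_simp` can clear it.
  set a := √ε
  set b := √σ
  obtain ⟨ρ, hρ, hr⟩ : ∃ ρ : ℝ, 0 ≤ ρ ∧ ‖y - x‖ = a / b * ρ :=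
    ⟨b / a * ‖y - x‖, by positivity, by field_simp⟩
  obtain ⟨w, hw0, hs⟩ : ∃ w : ℝ, 0 ≤ w ∧ ‖x - xk‖ = a / b * w :=
    ⟨b / a * ‖x - xk‖, by positivity, by field_simp⟩
  obtain ⟨S, hS0, hS⟩ : ∃ S : ℝ, 0 ≤ S ∧ L * w = b ^ 2 * S :=
    ⟨L * w / b ^ 2, by positivity, by field_simp⟩
  have hLs : L * ‖x - xk‖ = a * b * S := by
    rw [hs]; field_simp; linear_combination hS
  rw [hLs, hr] at hdec hgrad
  rw [hs, hr] at htri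
  rw [hs] at hw
  have hba : b / a * (a / b * w) = w := by field_simp
  rw [hba] at hw
  clear_value a b
  subst hεa hσb
  have hL12 : 12 * L ≤ b ^ 2 := le_trans (by nlinarith) hLσ
  have hnorm : 1 ≤ (3 / 4 + 1 / 24) * ρ ^ 2 + 1 / 72 + (5 / 96 + S) * ρ := by
    have h1 : (3 / 4 * b ^ 2 + L / 2) * (a / b * ρ) ^ 2
        ≤ (3 / 4 * b ^ 2 + b ^ 2 / 24) * (a / b * ρ) ^ 2 :=
      mul_le_mul_of_nonneg_right (by linarith) (sq_nonneg _)
    have h2 : a ^ 2 * 1 ≤ a ^ 2 * ((3 / 4 + 1 / 24) * ρ ^ 2 + 1 / 72 + (5 / 96 + S) * ρ) := by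
      have h3 : (3 / 4 * b ^ 2 + b ^ 2 / 24) * (a / b * ρ) ^ 2 + a ^ 2 / 72
          + (5 / 96 * (a * b) + a * b * S) * (a / b * ρ)
          = a ^ 2 * ((3 / 4 + 1 / 24) * ρ ^ 2 + 1 / 72 + (5 / 96 + S) * ρ) := by
        field_simp
      linarith
    exact le_of_mul_le_mul_left h2 (by positivity)
  have hone := normalized_decrease hS0 hρ hnorm
  -- From `12 * m * S ≤ w` and `w ^ 3 ≤ t ^ 2 * P`, with `32 / 12 ^ 3 = 1 / 54`.
  have hScube : 32 * S ^ 3 ≤ t ^ 2 * P / (54 * m ^ 3) := by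
    have h1 : 12 * m * S ≤ w := by
      have : b ^ 2 * (12 * m * S) ≤ b ^ 2 * w := by
        calc b ^ 2 * (12 * m * S) = 12 * L * m * w := by linear_combination - 12 * m * hS
          _ ≤ b ^ 2 * w := mul_le_mul_of_nonneg_right hLσ hw0
      exact le_of_mul_le_mul_left this (by positivity)
    have h2 := (pow_le_pow_left₀ (by positivity) h1 3).trans hw
    rw [le_div_iff₀ (by positivity)]
    linarith
  refine ⟨P + ρ ^ 3, by positivity, ?_, ?_⟩
  · refine le_trans ?_ (add_cube_le ht hP hw0 hρ hw)
    gcongr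
    calc b / a * ‖y - xk‖ ≤ b / a * (a / b * w + a / b * ρ) := by gcongr
      _ = w + ρ := by field_simp
  · have h1 : a ^ 3 / b * (11 / 72 * ρ ^ 3 - 1 / 72 * ρ - (5 / 96 + S) / 2 * ρ ^ 2)
        ≤ (b ^ 2 - L) / 6 * (a / b * ρ) ^ 3 - a ^ 2 / 72 * (a / b * ρ)
          - (5 / 96 * (a * b) + a * b * S) / 2 * (a / b * ρ) ^ 2 := by
      have h2 : (b ^ 2 - b ^ 2 / 12) / 6 * (a / b * ρ) ^ 3
          ≤ (b ^ 2 - L) / 6 * (a / b * ρ) ^ 3 := by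
        gcongr; linarith
      refine le_trans (le_of_eq ?_) (sub_le_sub_right (sub_le_sub_right h2 _) _)
      field_simp
      ring
    have h2 : 1 / 384 * (t + 1) + (1 / 48 - (t + 1) ^ 3 / (162 * m ^ 3)) * (P + ρ ^ 3)
        ≤ (1 / 384 * t + (1 / 48 - t ^ 3 / (162 * m ^ 3)) * P)
          + (11 / 72 * ρ ^ 3 - 1 / 72 * ρ - (5 / 96 + S) / 2 * ρ ^ 2) := by
      have h3 : (t ^ 3 + 3 * t ^ 2) / (162 * m ^ 3) * P
          ≤ (t + 1) ^ 3 / (162 * m ^ 3) * (P + ρ ^ 3) := by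
        have : 0 ≤ ρ ^ 3 := by positivity
        gcongr
        · linarith [show (t + 1) ^ 3 = t ^ 3 + 3 * t ^ 2 + 3 * t + 1 by ring]
        · linarith
      have h4 : (t ^ 3 + 3 * t ^ 2) / (162 * m ^ 3) * P
          = t ^ 3 / (162 * m ^ 3) * P + t ^ 2 * P / (54 * m ^ 3) := by
        field_simp
        ring
      linarith
    have h3 := mul_le_mul_of_nonneg_left h2 (by positivity : 0 ≤ a ^ 3 / b)
    rw [mul_add (a ^ 3 / b) (1 / 384 * t + _)] at h3
    linarith

end Descent

/-! ### The parameter choices meet the required accuracies. -/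

section Parameters

variable {n m ℓ : ℕ} {τ ε L : ℝ}

lemma rpow_three_halves {x : ℝ} (hx : 0 ≤ x) : x ^ (3 / 2 : ℝ) = √x ^ 3 := by
  rw [Real.sqrt_eq_rpow, ← Real.rpow_natCast, ← Real.rpow_mul hx]
  norm_num

lemma rpow_third_cube {x : ℝ} (hx : 0 ≤ x) : (x ^ (1 / 3 : ℝ)) ^ 3 = x := by
  rw [← Real.rpow_natCast, ← Real.rpow_mul hx]
  norm_num

lemma regularization_pos (hτ : 0 < τ) (hm : 1 ≤ m) : 0 < regularization m ℓ τ := by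
  unfold regularization; positivity

lemma mul_le_regularization (hτ : 0 < τ) :
    12 * (2 ^ ℓ * τ) * m ≤ regularization m ℓ τ := by
  have h : (3 / 4 : ℝ) ≤ (2 / 3 : ℝ) ^ (1 / 3 : ℝ) := by
    refine le_of_pow_le_pow_left₀ (n := 3) (by norm_num) (by positivity) ?_
    rw [rpow_third_cube (by norm_num)]
    norm_num
  unfold regularization
  have : (12 : ℝ) ≤ 2 ^ 4 * (2 / 3 : ℝ) ^ (1 / 3 : ℝ) := by linarith
  gcongr

lemma sqrt_regularization (hτ : 0 < τ) :
    √(regularization m ℓ τ) = 4 * (2 / 3 : ℝ) ^ (1 / 6 : ℝ) * √(2 ^ ℓ * τ) * √m := by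
  unfold regularization
  rw [Real.sqrt_mul (by positivity), Real.sqrt_mul (by positivity), Real.sqrt_mul (by positivity)]
  congr 3
  · rw [show (2 : ℝ) ^ 4 = 4 ^ 2 by norm_num]; exact Real.sqrt_sq (by norm_num)
  · rw [Real.sqrt_eq_rpow, ← Real.rpow_mul (by norm_num)]
    norm_num

lemma gradientInterval_pos (hn : 1 ≤ n) (hm : 1 ≤ m) {σ : ℝ} (hσ : 0 < σ) (hε : 0 < ε) :
    0 < gradientInterval n m σ ε := by
  unfold gradientInterval; positivity

lemma gradientInterval_error (hn : 1 ≤ n) (hτ : 0 < τ) (hm : 1 ≤ m) (hε : 0 < ε) (hL0 : 0 ≤ L)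
    (hL : L ≤ 2 ^ ℓ * τ) :
    √n * (L * gradientInterval n m (regularization m ℓ τ) ε ^ 2 / 6) ≤ ε / 72 := by
  have hσ := regularization_pos (ℓ := ℓ) hτ hm
  have h12 : 12 * L * m ≤ regularization m ℓ τ := le_trans (by gcongr) (mul_le_regularization hτ)
  set σ := regularization m ℓ τ
  have h3 : (1 : ℝ) ≤ (3 : ℝ) ^ (1 / 3 : ℝ) := Real.one_le_rpow (by norm_num) (by norm_num)
  have h4 : (1 / (3 : ℝ) ^ (1 / 3 : ℝ)) ^ 2 ≤ 1 :=
    pow_le_one₀ (by positivity) ((div_le_one (by positivity)).2 h3)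
  have h5 : gradientInterval n m σ ε ^ 2 ≤ ε * m / (σ * √n) := by
    unfold gradientInterval
    rw [mul_pow, ← Real.sqrt_eq_rpow, ← Real.sqrt_eq_rpow, Real.sq_sqrt (by positivity)]
    exact mul_le_of_le_one_left (by positivity) h4
  have hn' : 0 < √(n : ℝ) := Real.sqrt_pos.2 (by exact_mod_cast hn)
  calc √n * (L * gradientInterval n m σ ε ^ 2 / 6)
      ≤ √n * (L * (ε * m / (σ * √n)) / 6) := by gcongr
    _ = L * m / σ * (ε / 6) := by field_simp
    _ ≤ 1 / 12 * (ε / 6) := by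
      refine mul_le_mul_of_nonneg_right ?_ (by positivity)
      rw [div_le_iff₀ hσ]
      linarith
    _ = ε / 72 := by ring

lemma hessianInterval_pos (hn : 1 ≤ n) (hm : 1 ≤ m) (hτ : 0 < τ) (hε : 0 < ε) :
    0 < hessianInterval n m ℓ τ ε := by
  have := regularization_pos (ℓ := ℓ) hτ hm
  unfold hessianInterval; positivity

lemma hessianInterval_error (hn : 1 ≤ n) (hτ : 0 < τ) (hm : 1 ≤ m) (hε : 0 < ε)
    (hL : L ≤ 2 ^ ℓ * τ) :
    n * (5 / 3 * (L * hessianInterval n m ℓ τ ε))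
      ≤ 5 / 96 * (√ε * √(regularization m ℓ τ)) := by
  have hσ := regularization_pos (ℓ := ℓ) hτ hm
  have hh := hessianInterval_pos (ℓ := ℓ) hn hm hτ hε
  have hcube : hessianInterval n m ℓ τ ε ^ 3 = 3 ^ 4 * √(regularization m ℓ τ) ^ 3 * √ε ^ 3
      / (2 ^ 14 * 192 * (n : ℝ) ^ 3 * (2 ^ ℓ * τ) ^ 3) := by
    unfold hessianInterval
    rw [rpow_third_cube (by positivity), rpow_three_halves hσ.le, rpow_three_halves hε.le]
  set σ := regularization m ℓ τ
  set h := hessianInterval n m ℓ τ ε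
  have hn' : 0 < (n : ℝ) := by exact_mod_cast hn
  -- The formula for `h` makes the cube of the left side an explicit multiple of `(√ε * √σ) ^ 3`;
  -- then `5 / 3 * (1 / 32) = 5 / 96`.
  have key : n * (2 ^ ℓ * τ) * h ≤ √ε * √σ / 32 := by
    refine le_of_pow_le_pow_left₀ (n := 3) (by norm_num) (by positivity) ?_
    calc (n * (2 ^ ℓ * τ) * h) ^ 3 = (n * (2 ^ ℓ * τ)) ^ 3 * h ^ 3 := by ring
      _ = 81 / (2 ^ 14 * 192) * (√ε * √σ) ^ 3 := by rw [hcube]; field_simp; norm_num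
      _ ≤ 1 / 32 ^ 3 * (√ε * √σ) ^ 3 := mul_le_mul_of_nonneg_right (by norm_num) (by positivity)
      _ = _ := by ring
  have : n * (L * h) ≤ n * (2 ^ ℓ * τ) * h := by
    rw [mul_assoc]; gcongr
  linarith

end Parameters

/-! ### Following a run: calls, outer iterations, evaluation counts. -/

section Run

variable {n : ℕ} {f : Vec n → ℝ} {ψ : Vec n → EReal} {L τ₀ ε : ℝ} {m : ℕ} {x₀ : Vec n}
  {c : ℕ → Config n}

lemma Transition.k_le {a b : Config n} (h : Transition f ψ τ₀ ε m a b) : a.k ≤ b.k := by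
  cases h <;> simp

lemma Transition.length_evals_le {a b : Config n} (h : Transition f ψ τ₀ ε m a b) :
    a.evals.length ≤ b.evals.length := by
  cases h <;> simp

lemma IsRun.monotone_k (hc : IsRun f ψ τ₀ ε m x₀ c) : Monotone fun i => (c i).k :=
  monotone_nat_of_le_succ fun i => (hc.next i).k_le

lemma IsRun.monotone_length_evals (hc : IsRun f ψ τ₀ ε m x₀ c) :
    Monotone fun i => (c i).evals.length :=
  monotone_nat_of_le_succ fun i => (hc.next i).length_evals_le

lemma IsRun.evaluationsInFirst_le (hc : IsRun f ψ τ₀ ε m x₀ c) (i : ℕ) :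
    evaluationsInFirst c (c i).k ≤ ((c i).evals.length : ℕ∞) := by
  refine iSup₂_le fun j hj => ?_
  have hji : j < i := hc.monotone_k.reflect_lt hj
  exact_mod_cast hc.monotone_length_evals (Nat.succ_le_of_lt hji)

lemma length_gradientQueries (x : Vec n) (h : ℝ) : (gradientQueries x h).length = 2 * n := by
  simp [gradientQueries, mul_comm]

lemma length_hessianQueries (x : Vec n) (h : ℝ) :
    (hessianQueries x h).length = 1 + 3 * n ^ 2 := by
  simp [hessianQueries]
  ring

/-- The result of a call of the cubic-steps procedure within the inner loop `ℓ`: success with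
sufficient decrease, or a halt, which is impossible when `2 ^ ℓ * τ` is at least `L`. -/
def CallOutcome (f : Vec n → ℝ) (ψ : Vec n → EReal) (L τ₀ ε : ℝ) (m k ℓ : ℕ) (xk : Vec n) (τ : ℝ)
    (budget : ℕ) (a : Config n) : Prop :=
  (∃ x ev, a = ⟨k + 1, 0, x, max τ₀ ((2 : ℝ) ^ ((ℓ : ℤ) - 1) * τ), .estimate, ev⟩ ∧
    x ∈ dom ψ ∧ ev.length ≤ budget ∧
    √ε ^ 3 / √(regularization m ℓ τ) * (1 / 384 * m) ≤ objective f ψ xk - objective f ψ x) ∨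
  (∃ ev, a = ⟨k, ℓ + 1, xk, τ, .estimate, ev⟩ ∧ ev.length ≤ budget ∧ 2 ^ ℓ * τ < L)

lemma decrease_threshold_eq {σ : ℝ} (hε : 0 < ε) (t : ℝ) :
    ε ^ (3 / 2 : ℝ) / (384 * σ ^ (1 / 2 : ℝ)) * t = √ε ^ 3 / √σ * (1 / 384 * t) := by
  rw [rpow_three_halves hε.le, ← Real.sqrt_eq_rpow]
  ring

/-- A nonstationary iterate excludes `n = 0`, where the finite-difference intervals degenerate. -/
lemma pos_of_lt_norm {v : Vec n} (hε : 0 < ε) (h : ε < ‖v‖) : 1 ≤ n := by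
  rcases Nat.eq_zero_or_pos n with rfl | hn
  · rw [Subsingleton.elim v 0, norm_zero] at h
    linarith
  · exact hn

/-- Induction on the number `s` of remaining steps. The plain decrease is what the tests have
certified, whatever `τ` is; `AccumulatedDecrease` is carried only when `L ≤ 2 ^ ℓ * τ`, to
contradict a halt. -/
lemma IsRun.exists_callOutcome_of_loop (hf : ContDiff ℝ 2 f) (hL0 : 0 ≤ L)
    (hL : ∀ x y, ‖hessian f y - hessian f x‖ ≤ L * ‖y - x‖)
    (hε : 0 < ε) (hm : 1 ≤ m) (hc : IsRun f ψ τ₀ ε m x₀ c)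
    {k ℓ : ℕ} {xk : Vec n} {τ : ℝ} (hτ : 0 < τ) (hns : k ∉ stationaryIterations f ψ ε m c)
    (s : ℕ) :
    ∀ (i t : ℕ) (x : Vec n) (ev : List (Vec n)), t + s = m →
      c i = ⟨k, ℓ, xk, τ, .loop t x (fdHessian f xk (hessianInterval n m ℓ τ ε)), ev⟩ →
      x ∈ dom ψ →
      √ε ^ 3 / √(regularization m ℓ τ) * (1 / 384 * t) ≤ objective f ψ xk - objective f ψ x →
      (L ≤ 2 ^ ℓ * τ →
        AccumulatedDecrease (objective f ψ) ε (regularization m ℓ τ) m xk t x) →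
      ∃ j, CallOutcome f ψ L τ₀ ε m k ℓ xk τ (ev.length + s * (2 * n + 1)) (c j) := by
  have hσ := regularization_pos (ℓ := ℓ) hτ hm
  have hm' : (1 : ℝ) ≤ m := by exact_mod_cast hm
  induction s with
  | zero =>
    intro i t x ev hts hci hx hdec _
    obtain rfl : t = m := by omega
    have h := hc.next i
    rw [hci] at h
    generalize hb : c (i + 1) = b at h
    cases h with
    | cubic _ _ _ _ _ _ _ _ y v ht hy => exact absurd ht (lt_irrefl _)
    | success => exact ⟨i + 1, .inl ⟨x, ev, hb, hx, by simp, hdec⟩⟩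
  | succ s ih =>
    intro i t x ev hts hci hx hdec hacc
    have h := hc.next i
    rw [hci] at h
    generalize hb : c (i + 1) = b at h
    cases h with
    | success => omega
    | cubic _ _ _ _ _ _ _ _ y v ht hy =>
      have hgrad : ε < ‖gradient f y + v‖ := by
        by_contra! hle
        exact hns ⟨i + 1, ℓ, t + 1, y, v, by rw [hb], by rw [hb], ht,
          by rw [hb]; exact ⟨rfl, rfl, rfl⟩, hle⟩
      have hn := pos_of_lt_norm hε hgrad
      have hacc' : L ≤ 2 ^ ℓ * τ →
          AccumulatedDecrease (objective f ψ) ε (regularization m ℓ τ) m xk (t + 1) y := by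
        intro hLτ
        have hhg := gradientInterval_pos hn hm hσ hε
        have hh := hessianInterval_pos (ℓ := ℓ) hn hm hτ hε
        refine (hacc hLτ).step hf hL0 hL hε hσ hm' (Nat.cast_nonneg t)
          (le_trans (by gcongr) (mul_le_regularization hτ)) (fdHessian_isHermitian f xk _)
          ((norm_fdGradient_sub_le hf hL0 hL x hhg).trans
            (gradientInterval_error hn hτ hm hε hL0 hLτ)) (fun d => ?_) hy hgrad
        exact (norm_fdHessian_sub_le hf hL0 hL xk hh d).trans
          (mul_le_mul_of_nonneg_right (hessianInterval_error hn hτ hm hε hLτ) (norm_nonneg d))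
      have h := hc.next (i + 1)
      rw [hb] at h
      generalize hb' : c (i + 1 + 1) = b' at h
      cases h with
      | accept _ _ _ _ _ _ _ _ _ hdec' =>
        rw [decrease_threshold_eq hε] at hdec'
        obtain ⟨j, hj⟩ := ih (i + 1 + 1) (t + 1) y _ (by omega) hb' hy.mem_dom
          (by exact_mod_cast hdec') (by exact_mod_cast hacc')
        refine ⟨j, ?_⟩
        convert hj using 1
        simp [length_gradientQueries]
        ring
      | halt _ _ _ _ _ _ _ _ _ hdec' =>
        rw [decrease_threshold_eq hε] at hdec'
        refine ⟨i + 1 + 1, .inr ⟨_, hb', ?_, ?_⟩⟩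
        · simp only [List.length_append, length_gradientQueries, List.length_singleton]
          have : 0 ≤ s * (2 * n + 1) := Nat.zero_le _
          linarith
        · by_contra! hLτ
          have := (hacc' hLτ).le (by linarith) (by positivity) (by exact_mod_cast ht)
          linarith

/-- The number of evaluations of `f` that one pass of the inner loop costs at most. -/
def callCost (n m : ℕ) : ℕ := 1 + 3 * n ^ 2 + m * (2 * n + 1)

lemma IsRun.exists_callOutcome (hf : ContDiff ℝ 2 f) (hL0 : 0 ≤ L)
    (hL : ∀ x y, ‖hessian f y - hessian f x‖ ≤ L * ‖y - x‖)
    (hε : 0 < ε) (hm : 1 ≤ m) (hc : IsRun f ψ τ₀ ε m x₀ c)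
    {k ℓ : ℕ} {xk : Vec n} {τ : ℝ} (hτ : 0 < τ) (hns : k ∉ stationaryIterations f ψ ε m c)
    {i : ℕ} {ev : List (Vec n)} (hci : c i = ⟨k, ℓ, xk, τ, .estimate, ev⟩) (hxk : xk ∈ dom ψ) :
    ∃ j, CallOutcome f ψ L τ₀ ε m k ℓ xk τ (ev.length + callCost n m) (c j) := by
  have h := hc.next i
  rw [hci] at h
  generalize hb : c (i + 1) = b at h
  cases h with
  | estimate =>
    obtain ⟨j, hj⟩ := hc.exists_callOutcome_of_loop hf hL0 hL hε hm hτ hns m (i + 1) 0 xk _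
      (by simp) hb hxk (by simp) fun _ => by simpa using AccumulatedDecrease.refl _ _ _ _ _
    refine ⟨j, ?_⟩
    convert hj using 1
    simp [length_hessianQueries, callCost]
    ring

/-- The decrease of `F` that each outer iteration guarantees. -/
def outerDecrease (L τ₀ ε : ℝ) (m : ℕ) : ℝ :=
  ε ^ (3 / 2 : ℝ) * √m
    / (384 * (2 : ℝ) ^ (5 / 2 : ℝ) * (2 / 3 : ℝ) ^ (1 / 6 : ℝ) * max τ₀ L ^ (1 / 2 : ℝ))

lemma outerDecrease_pos (hτ₀ : 0 < τ₀) (hε : 0 < ε) (hm : 1 ≤ m) :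
    0 < outerDecrease L τ₀ ε m := by
  have : 0 < max τ₀ L := lt_max_of_lt_left hτ₀
  unfold outerDecrease; positivity

lemma outerDecrease_le (hε : 0 < ε) (hm : 1 ≤ m) {ℓ : ℕ} {τ : ℝ} (hτ : 0 < τ)
    (h : 2 ^ ℓ * τ ≤ 2 * max τ₀ L) :
    outerDecrease L τ₀ ε m ≤ √ε ^ 3 / √(regularization m ℓ τ) * (1 / 384 * m) := by
  have hM : 0 < max τ₀ L := by
    have : 0 < (2 : ℝ) ^ ℓ * τ := by positivity
    linarith
  have h1 : √(2 ^ ℓ * τ) ≤ √2 * √(max τ₀ L) := by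
    rw [← Real.sqrt_mul (by norm_num)]
    exact Real.sqrt_le_sqrt h
  have h2 : (2 : ℝ) ^ (5 / 2 : ℝ) = 4 * √2 := by
    rw [show (5 / 2 : ℝ) = 2 + 1 / 2 by norm_num, Real.rpow_add (by norm_num),
      ← Real.sqrt_eq_rpow]
    norm_num
  have hm0 : 0 < √(m : ℝ) := Real.sqrt_pos.2 (by exact_mod_cast hm)
  rw [sqrt_regularization hτ]
  unfold outerDecrease
  rw [h2, rpow_three_halves hε.le, ← Real.sqrt_eq_rpow]
  have hmm : (m : ℝ) = √m * √m := (Real.mul_self_sqrt (Nat.cast_nonneg m)).symm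
  have hpos : 0 < √(2 ^ ℓ * τ) := Real.sqrt_pos.2 (by positivity)
  calc √ε ^ 3 * √m / (384 * (4 * √2) * (2 / 3 : ℝ) ^ (1 / 6 : ℝ) * √(max τ₀ L))
      = √ε ^ 3 * √m / (384 * 4 * (2 / 3 : ℝ) ^ (1 / 6 : ℝ) * (√2 * √(max τ₀ L))) := by ring
    _ ≤ √ε ^ 3 * √m / (384 * 4 * (2 / 3 : ℝ) ^ (1 / 6 : ℝ) * √(2 ^ ℓ * τ)) := by gcongr
    _ = √ε ^ 3 / (4 * (2 / 3 : ℝ) ^ (1 / 6 : ℝ) * √(2 ^ ℓ * τ) * √m)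
        * (1 / 384 * (√m * √m)) := by field_simp
    _ = _ := by rw [← hmm]

/-- The state of the method at the start of the outer iteration `k`. -/
def OuterState (f : Vec n → ℝ) (ψ : Vec n → EReal) (L τ₀ ε : ℝ) (m : ℕ) (x₀ : Vec n) (k : ℕ)
    (a : Config n) : Prop :=
  ∃ x τ ev, a = ⟨k, 0, x, τ, .estimate, ev⟩ ∧ x ∈ dom ψ ∧ τ₀ ≤ τ ∧ τ ≤ max τ₀ L ∧
    k * outerDecrease L τ₀ ε m ≤ objective f ψ x₀ - objective f ψ x ∧
    (ev.length : ℝ) ≤ callCost n m * (2 * k + Real.logb 2 (τ / τ₀))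

lemma zpow_sub_one_mul_le {ℓ : ℕ} {τ : ℝ} (hτ : 0 < τ) (hτM : τ ≤ max τ₀ L)
    (hprev : ∀ p < ℓ, 2 ^ p * τ < L) : (2 : ℝ) ^ ((ℓ : ℤ) - 1) * τ ≤ max τ₀ L := by
  rcases ℓ with - | p
  · norm_num
    rcases le_max_iff.1 hτM with h | h
    · left; linarith
    · right; linarith
  · have := hprev p (Nat.lt_succ_self p)
    simp only [Nat.cast_add, Nat.cast_one, add_sub_cancel_right, zpow_natCast]
    exact this.le.trans (le_max_right _ _)

lemma IsRun.exists_outerState_succ (hf : ContDiff ℝ 2 f) (hL0 : 0 ≤ L)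
    (hL : ∀ x y, ‖hessian f y - hessian f x‖ ≤ L * ‖y - x‖)
    (hτ₀ : 0 < τ₀) (hε : 0 < ε) (hm : 1 ≤ m) (hc : IsRun f ψ τ₀ ε m x₀ c)
    {k i : ℕ} (hns : k ∉ stationaryIterations f ψ ε m c)
    (hk : OuterState f ψ L τ₀ ε m x₀ k (c i)) :
    ∃ j, OuterState f ψ L τ₀ ε m x₀ (k + 1) (c j) := by
  obtain ⟨x, τ, ev, hci, hx, hτ₀τ, hτM, hdec, hev⟩ := hk
  have hτ : 0 < τ := hτ₀.trans_le hτ₀τ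
  by_contra! hcon
  have key : ∀ ℓ : ℕ, (∀ p < ℓ, 2 ^ p * τ < L) ∧
      ∃ j ev', c j = ⟨k, ℓ, x, τ, .estimate, ev'⟩ ∧
        (ev'.length : ℝ) ≤ callCost n m * (2 * k + Real.logb 2 (τ / τ₀) + ℓ) := by
    intro ℓ
    induction ℓ with
    | zero => exact ⟨by simp, i, ev, hci, by simpa using hev⟩
    | succ ℓ ih =>
      obtain ⟨hprev, j, ev', hcj, hev'⟩ := ih
      obtain ⟨j', hj'⟩ := hc.exists_callOutcome hf hL0 hL hε hm hτ hns hcj hx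
      rcases hj' with ⟨x', ev'', hcj', hx', hev'', hdec'⟩ | ⟨ev'', hcj', hev'', hlt⟩
      · exfalso
        have hle := zpow_sub_one_mul_le hτ hτM hprev
        have hpow : (2 : ℝ) ^ ((ℓ : ℤ) - 1) = 2 ^ ℓ / 2 := by
          rw [zpow_sub_one₀ (by norm_num), zpow_natCast]; rfl
        refine hcon j' ⟨x', _, ev'', hcj', hx', le_max_left _ _,
          -- The loop `ℓ - 1` halted (or `ℓ = 0`), so the new `τ` is at most `max τ₀ L`, and the
          -- successful `2 ^ ℓ * τ` at most twice that. This is the factor `2` in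
          -- `outerDecrease_le`.
          max_le (le_max_left _ _) hle, ?_, ?_⟩
        · have := outerDecrease_le (m := m) (ε := ε) hε hm hτ (ℓ := ℓ) (L := L) (τ₀ := τ₀)
            (by rw [hpow] at hle; linarith)
          push_cast
          linarith
        -- Success at `ℓ` means `ℓ + 1` calls, while `log₂ τ` grows by at least `ℓ - 1`; the
        -- difference is the `2` charged to each outer iteration.
        · have hlog : (ℓ : ℝ) - 1 + Real.logb 2 (τ / τ₀)
              ≤ Real.logb 2 (max τ₀ ((2 : ℝ) ^ ((ℓ : ℤ) - 1) * τ) / τ₀) := by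
            have h1 : (ℓ : ℝ) - 1 + Real.logb 2 (τ / τ₀)
                = Real.logb 2 ((2 : ℝ) ^ ((ℓ : ℤ) - 1) * (τ / τ₀)) := by
              rw [Real.logb_mul (by positivity) (by positivity), ← Real.rpow_intCast,
                Real.logb_rpow (by norm_num) (by norm_num)]
              simp
            rw [h1, ← mul_div_assoc]
            refine Real.logb_le_logb_of_le (by norm_num) (by positivity) ?_
            gcongr
            exact le_max_right _ _
          have h2 : (ev''.length : ℝ) ≤ ev'.length + callCost n m := by exact_mod_cast hev''
          calc (ev''.length : ℝ)
              ≤ callCost n m * (2 * k + Real.logb 2 (τ / τ₀) + ℓ) + callCost n m := by linarith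
            _ = callCost n m * (2 * (k + 1) + (ℓ - 1 + Real.logb 2 (τ / τ₀))) := by ring
            _ ≤ _ := by push_cast; gcongr
      · refine ⟨fun p hp => ?_, j', ev'', hcj', ?_⟩
        · rcases Nat.lt_succ_iff_lt_or_eq.1 hp with h | rfl
          · exact hprev p h
          · exact hlt
        · have h2 : (ev''.length : ℝ) ≤ ev'.length + callCost n m := by exact_mod_cast hev''
          push_cast
          linarith
  -- Without success every loop halts, contrary to `2 ^ p * τ > L` for large `p`.
  obtain ⟨p, hp⟩ := pow_unbounded_of_one_lt (L / τ) (one_lt_two (α := ℝ))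
  have := (key (p + 1)).1 p (Nat.lt_succ_self p)
  rw [div_lt_iff₀ hτ] at hp
  linarith

lemma IsRun.exists_outerState (hf : ContDiff ℝ 2 f) (hL0 : 0 ≤ L)
    (hL : ∀ x y, ‖hessian f y - hessian f x‖ ≤ L * ‖y - x‖)
    (hτ₀ : 0 < τ₀) (hε : 0 < ε) (hm : 1 ≤ m) (hx₀ : x₀ ∈ dom ψ)
    (hc : IsRun f ψ τ₀ ε m x₀ c) (T : ℕ)
    (hns : ∀ k < T, k ∉ stationaryIterations f ψ ε m c) :
    ∃ i, OuterState f ψ L τ₀ ε m x₀ T (c i) := by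
  induction T with
  | zero => exact ⟨0, x₀, τ₀, [], hc.init, hx₀, le_rfl, le_max_left _ _, by simp,
      by simp [hτ₀.ne']⟩
  | succ T ih =>
    obtain ⟨i, hi⟩ := ih fun k hk => hns k (hk.trans (Nat.lt_succ_self T))
    exact hc.exists_outerState_succ hf hL0 hL hτ₀ hε hm (hns T (Nat.lt_succ_self T)) hi

lemma OuterState.natCast_le (hτ₀ : 0 < τ₀) (hε : 0 < ε) (hm : 1 ≤ m)
    (hbdd : BddBelow (objective f ψ '' dom ψ)) {T : ℕ} {a : Config n}
    (h : OuterState f ψ L τ₀ ε m x₀ T a) :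
    (T : ℝ) ≤ (objective f ψ x₀ - optimalValue f ψ) / outerDecrease L τ₀ ε m := by
  obtain ⟨x, τ, ev, -, hx, -, -, hdec, -⟩ := h
  rw [le_div_iff₀ (outerDecrease_pos hτ₀ hε hm)]
  have : optimalValue f ψ ≤ objective f ψ x := csInf_le hbdd ⟨x, hx, rfl⟩
  linarith

lemma div_outerDecrease (hε : 0 < ε) (D : ℝ) :
    D / outerDecrease L τ₀ ε m = 384 * (2 : ℝ) ^ (5 / 2 : ℝ) * (2 / 3 : ℝ) ^ (1 / 6 : ℝ)
      * max τ₀ L ^ (1 / 2 : ℝ) * D / √m * ε ^ (-(3 / 2) : ℝ) := by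
  unfold outerDecrease
  rw [Real.rpow_neg hε.le]
  field_simp

lemma IsRun.nonempty_stationaryIterations (hf : ContDiff ℝ 2 f) (hL0 : 0 ≤ L)
    (hL : ∀ x y, ‖hessian f y - hessian f x‖ ≤ L * ‖y - x‖)
    (hτ₀ : 0 < τ₀) (hε : 0 < ε) (hm : 1 ≤ m)
    (hbdd : BddBelow (objective f ψ '' dom ψ)) (hx₀ : x₀ ∈ dom ψ)
    (hc : IsRun f ψ τ₀ ε m x₀ c) : (stationaryIterations f ψ ε m c).Nonempty := by
  by_contra hemp
  rw [not_nonempty_iff_eq_empty] at hemp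
  obtain ⟨T, hT⟩ := exists_nat_gt
    ((objective f ψ x₀ - optimalValue f ψ) / outerDecrease L τ₀ ε m)
  obtain ⟨i, hi⟩ := hc.exists_outerState hf hL0 hL hτ₀ hε hm hx₀ T (by simp [hemp])
  exact absurd (hi.natCast_le hτ₀ hε hm hbdd) (not_le.2 hT)

lemma IsRun.zero_mem_stationaryIterations_of_subsingleton [Subsingleton (Vec n)] (hε : 0 < ε)
    (hx₀ : x₀ ∈ dom ψ) (hc : IsRun f ψ τ₀ ε m x₀ c) : 0 ∈ stationaryIterations f ψ ε m c := by
  have h := hc.next 0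
  rw [hc.init] at h
  generalize hb : c (0 + 1) = b at h
  cases h with
  | estimate =>
    refine ⟨0 + 1, 0, 0, x₀, 0, by rw [hb], by rw [hb], Nat.zero_le m, ?_, ?_⟩
    · rw [hb]
      refine ⟨rfl, rfl, rfl, hx₀, fun y => ?_⟩
      rw [Subsingleton.elim y x₀]
      simp
    · rw [Subsingleton.elim (gradient f x₀ + 0) 0, norm_zero]
      exact hε.le

lemma callCost_le (hn : 1 ≤ n) (hm : 1 ≤ m) :
    (callCost n m : ℝ) ≤ 4 * ((m : ℝ) * n + (n : ℝ) ^ 2) := by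
  have hn' : (1 : ℝ) ≤ n := by exact_mod_cast hn
  have hm' : (1 : ℝ) ≤ m := by exact_mod_cast hm
  unfold callCost
  push_cast
  nlinarith

lemma OuterState.length_evals_le (hn : 1 ≤ n) (hτ₀ : 0 < τ₀) (hε : 0 < ε) (hm : 1 ≤ m)
    (hbdd : BddBelow (objective f ψ '' dom ψ)) {T : ℕ} {a : Config n}
    (h : OuterState f ψ L τ₀ ε m x₀ T a) :
    (a.evals.length : ℝ) ≤
      8 * ((m : ℝ) * n + (n : ℝ) ^ 2)
          * ((objective f ψ x₀ - optimalValue f ψ) / outerDecrease L τ₀ ε m)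
        + 4 * (((m : ℝ) * n + 3 * (n : ℝ) ^ 2) * Real.logb 2 (max τ₀ L / τ₀)) := by
  have hT := h.natCast_le hτ₀ hε hm hbdd
  obtain ⟨x, τ, ev, rfl, -, hτ₀τ, hτM, -, hev⟩ := h
  have hτ : 0 < τ := hτ₀.trans_le hτ₀τ
  have hlog0 : 0 ≤ Real.logb 2 (τ / τ₀) :=
    Real.logb_nonneg (by norm_num) ((one_le_div hτ₀).2 hτ₀τ)
  have hlog : Real.logb 2 (τ / τ₀) ≤ Real.logb 2 (max τ₀ L / τ₀) :=
    Real.logb_le_logb_of_le (by norm_num) (by positivity) (by gcongr)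
  have hcost := callCost_le hn hm
  have hcost' : (callCost n m : ℝ) ≤ 4 * ((m : ℝ) * n + 3 * (n : ℝ) ^ 2) := by
    linarith [sq_nonneg (n : ℝ)]
  have h1 : (callCost n m : ℝ) * T ≤ 4 * ((m : ℝ) * n + (n : ℝ) ^ 2)
      * ((objective f ψ x₀ - optimalValue f ψ) / outerDecrease L τ₀ ε m) :=
    mul_le_mul hcost hT (Nat.cast_nonneg T) (by positivity)
  have h2 : (callCost n m : ℝ) * Real.logb 2 (τ / τ₀) ≤ 4 * ((m : ℝ) * n + 3 * (n : ℝ) ^ 2)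
      * Real.logb 2 (max τ₀ L / τ₀) :=
    mul_le_mul hcost' hlog hlog0 (by positivity)
  simp only at hev ⊢
  linarith

end Run

end ZeroOrderCNM

end

/-! ### Assembly of the complexity bounds. -/

theorem mainTheorem5 :
    ∃ C : ℝ, 0 < C ∧
      ∀ (n : ℕ) (f : ZeroOrderCNM.Vec n → ℝ) (ψ : ZeroOrderCNM.Vec n → EReal) (L : ℝ)
        (τ₀ ε : ℝ) (m : ℕ) (x₀ : ZeroOrderCNM.Vec n) (c : ℕ → ZeroOrderCNM.Config n),
        ContDiff ℝ 2 f →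
        0 ≤ L →
        (∀ x y, ‖ZeroOrderCNM.hessian f y - ZeroOrderCNM.hessian f x‖ ≤ L * ‖y - x‖) →
        ZeroOrderCNM.IsProperClosedConvex ψ →
        BddBelow (ZeroOrderCNM.objective f ψ '' ZeroOrderCNM.dom ψ) →
        0 < τ₀ → 0 < ε → 1 ≤ m →
        x₀ ∈ ZeroOrderCNM.dom ψ →
        ZeroOrderCNM.IsRun f ψ τ₀ ε m x₀ c →
        ∃ T : ℕ,
          IsLeast (ZeroOrderCNM.stationaryIterations f ψ ε m c) T ∧
          (T : ℝ) ≤ 384 * (2 : ℝ) ^ (5 / 2 : ℝ) * (2 / 3 : ℝ) ^ (1 / 6 : ℝ)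
              * max τ₀ L ^ (1 / 2 : ℝ)
              * (ZeroOrderCNM.objective f ψ x₀ - ZeroOrderCNM.optimalValue f ψ)
              / Real.sqrt m * ε ^ (-(3 / 2) : ℝ) ∧
          ∃ N : ℕ, ZeroOrderCNM.evaluationsInFirst c T = (N : ℕ∞) ∧
            (N : ℝ) ≤ C *
              (((m : ℝ) * n + (n : ℝ) ^ 2) / Real.sqrt m * max τ₀ L ^ (1 / 2 : ℝ)
                  * (ZeroOrderCNM.objective f ψ x₀ - ZeroOrderCNM.optimalValue f ψ)
                  * ε ^ (-(3 / 2) : ℝ)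
                + ((m : ℝ) * n + 3 * (n : ℝ) ^ 2) * Real.logb 2 (max τ₀ L / τ₀)) := by
  refine ⟨8 * (384 * (2 : ℝ) ^ (5 / 2 : ℝ) * (2 / 3 : ℝ) ^ (1 / 6 : ℝ)) + 4, by positivity, ?_⟩
  intro n f ψ L τ₀ ε m x₀ c hf hL0 hL _ hbdd hτ₀ hε hm hx₀ hc
  have hne := hc.nonempty_stationaryIterations hf hL0 hL hτ₀ hε hm hbdd hx₀
  set T := sInf (ZeroOrderCNM.stationaryIterations f ψ ε m c)
  have hT : IsLeast (ZeroOrderCNM.stationaryIterations f ψ ε m c) T :=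
    ⟨Nat.sInf_mem hne, fun k hk => Nat.sInf_le hk⟩
  obtain ⟨i, hi⟩ := hc.exists_outerState hf hL0 hL hτ₀ hε hm hx₀ T
    fun k hk hmem => absurd (hT.2 hmem) (not_le.2 hk)
  have hik : (c i).k = T := by
    obtain ⟨_, _, _, h, -⟩ := hi
    rw [h]
  have hTle := hi.natCast_le hτ₀ hε hm hbdd
  have hevals := hc.evaluationsInFirst_le i
  rw [hik] at hevals
  obtain ⟨N, hN⟩ := ENat.ne_top_iff_exists.1 (ne_top_of_le_ne_top (ENat.natCast_ne_top _) hevals)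
  have hNle : N ≤ (c i).evals.length := by rw [← hN] at hevals; exact_mod_cast hevals
  refine ⟨T, hT, hTle.trans_eq (ZeroOrderCNM.div_outerDecrease hε _), N, hN.symm, ?_⟩
  have hM : 0 < max τ₀ L := lt_max_of_lt_left hτ₀
  have hlog : 0 ≤ Real.logb 2 (max τ₀ L / τ₀) :=
    Real.logb_nonneg (by norm_num) ((one_le_div hτ₀).2 (le_max_left _ _))
  have hD : 0 ≤ ZeroOrderCNM.objective f ψ x₀ - ZeroOrderCNM.optimalValue f ψ :=
    sub_nonneg.2 (csInf_le hbdd ⟨x₀, hx₀, rfl⟩)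
  -- For `n = 0` the claimed bound is `0` although a call still costs `1 + m`; here `x₀` itself is
  -- stationary, so `T = 0` and nothing is counted.
  rcases Nat.eq_zero_or_pos n with rfl | hn
  · have hT0 : T = 0 :=
      Nat.le_zero.1 (hT.2 (hc.zero_mem_stationaryIterations_of_subsingleton hε hx₀))
    have hN0 : N = 0 := by
      rw [hT0] at hN
      simpa [ZeroOrderCNM.evaluationsInFirst] using hN
    rw [hN0, Nat.cast_zero]
    positivity
  · have hlen := (Nat.cast_le (α := ℝ).2 hNle).trans (hi.length_evals_le hn hτ₀ hε hm hbdd)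
    rw [ZeroOrderCNM.div_outerDecrease hε] at hlen
    have hX : 0 ≤ ((m : ℝ) * n + (n : ℝ) ^ 2) / √m * max τ₀ L ^ (1 / 2 : ℝ)
        * (ZeroOrderCNM.objective f ψ x₀ - ZeroOrderCNM.optimalValue f ψ)
        * ε ^ (-(3 / 2) : ℝ) := by positivity
    have hY : 0 ≤ ((m : ℝ) * n + 3 * (n : ℝ) ^ 2) * Real.logb 2 (max τ₀ L / τ₀) := by positivity
    have hK : 0 ≤ 8 * (384 * (2 : ℝ) ^ (5 / 2 : ℝ) * (2 / 3 : ℝ) ^ (1 / 6 : ℝ)) := by positivity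
    refine (hlen.trans_eq ?_).trans
      ((add_le_add (mul_le_mul_of_nonneg_right (le_add_of_nonneg_right zero_le_four) hX)
        (mul_le_mul_of_nonneg_right (le_add_of_nonneg_left hK) hY)).trans_eq (mul_add _ _ _).symm)
    ring
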